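/- A real random variable $\xi$ is called *subgaussian* if it is integrable with $\mathbf E\xi=0$ and there is a constant $\tau\ge 0$ such that $\mathbf E e^{t\xi}\le e^{t^2\tau^2/2}$ for all $t\in\mathbb R$; a subgaussian $\xi$ is called *strictly subgaussian* if $\mathbf E e^{t\xi}\le e^{t^2\operatorname{Var}(\xi)/2}$ for all $t\in\mathbb R$. Let $\alpha>-1$ and $\beta>2$, and let $\gamma$ be a random variable with density $$g_{\alpha,\beta}(x)=\frac12\cdot\frac{\beta\,|x|^{\alpha}e^{-|x|^{\beta}}}{\Gamma((\alpha+1)/\beta)},\qquad x\in\mathbb R .$$ Put $$\theta=\max(\alpha-\beta+1,\,1),\qquad k_0=\max\bigl(1,\,(\beta-\alpha-1)/2\bigr),$$ $$G_1=\sqrt{\pi}\;\Gamma\!\left(\tfrac{\alpha+1}{\beta}\right)e^{-3/8}\,e^{-\theta/(2\beta)},\qquad G_2=\frac{e}{4}\cdot\frac{\Gamma((\alpha+1)/\beta)}{\Gamma((\alpha+3)/\beta)}\cdot\left[\frac{2}{\beta}\left(1+\frac{\theta}{2k_0}\right)\right]^{2/\beta},$$ $$G=\bigl[\max(1,G_1)\,G_2\bigr]^{\beta/(\beta-2)},$$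 and, for integers $k\ge 0$, $$\zeta(k)=\Gamma\!\left(\tfrac{\alpha+2k+1}{\beta}\right)\cdot\frac{2^k\,k!}{(2k)!}\cdot\frac{\Gamma((\alpha+1)/\beta)^{\,k-1}}{\Gamma((\alpha+3)/\beta)^{\,k}} .$$ **Theorem.** If $\zeta(k)\le 1$ for all integers $k\ge 0$ with $k<G$, then $\gamma$ is strictly subgaussian. -/

import Mathlib

open MeasureTheory ProbabilityTheory

/-- A real random variable `X` is subgaussian if it is integrable and centered and, for some
`τ ≥ 0`, its moment generating function exists everywhere with `E exp (t X) ≤ exp (t² τ² / 2)`. -/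
structure IsSubgaussian {Ω : Type*} [MeasurableSpace Ω] (X : Ω → ℝ) (P : Measure Ω) : Prop where
  integrable : Integrable X P
  centered : ∫ ω, X ω ∂P = 0
  exists_bound : ∃ τ : ℝ, 0 ≤ τ ∧ ∀ t : ℝ, Integrable (fun ω => Real.exp (t * X ω)) P ∧
    ∫ ω, Real.exp (t * X ω) ∂P ≤ Real.exp (t ^ 2 * τ ^ 2 / 2)

/-- A subgaussian random variable `X` is strictly subgaussian if
`E exp (t X) ≤ exp (t² Var(X) / 2)` for all real `t`. (The exponential moments are finite and `X`
is square integrable, because `X` is subgaussian.) -/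
structure IsStrictlySubgaussian {Ω : Type*} [MeasurableSpace Ω] (X : Ω → ℝ) (P : Measure Ω) :
    Prop where
  isSubgaussian : IsSubgaussian X P
  mgf_le : ∀ t : ℝ,
    ∫ ω, Real.exp (t * X ω) ∂P ≤ Real.exp (t ^ 2 * variance X P / 2)

/-- The symmetrized generalized gamma density. -/
noncomputable def symGammaDensity (α β x : ℝ) : ℝ :=
  (1 / 2) * (β * |x| ^ α * Real.exp (-(|x| ^ β))) / Real.Gamma ((α + 1) / β)

/-- The law on `ℝ` with the symmetrized generalized gamma density. -/
noncomputable def symGammaLaw (α β : ℝ) : Measure ℝ :=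
  volume.withDensity (fun x => ENNReal.ofReal (symGammaDensity α β x))

/-- `ζ(k) = (E γ^{2k} / (2k)!) / ((E γ²)^k / (2^k k!))` in terms of the Gamma function; the
exponent `k - 1` is an integer (it is `-1` for `k = 0`). -/
noncomputable def symGammaZeta (α β : ℝ) (k : ℕ) : ℝ :=
  Real.Gamma ((α + 2 * k + 1) / β) * (2 ^ k * (k.factorial : ℝ) / ((2 * k).factorial : ℝ)) *
    (Real.Gamma ((α + 1) / β) ^ ((k : ℤ) - 1) / Real.Gamma ((α + 3) / β) ^ k)

noncomputable def symGammaTheta (α β : ℝ) : ℝ := max (α - β + 1) 1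

noncomputable def symGammaK0 (α β : ℝ) : ℝ := max 1 ((β - α - 1) / 2)

noncomputable def symGammaG1 (α β : ℝ) : ℝ :=
  Real.sqrt Real.pi * Real.Gamma ((α + 1) / β) * Real.exp (-(3 / 8)) *
    Real.exp (-(symGammaTheta α β / (2 * β)))

noncomputable def symGammaG2 (α β : ℝ) : ℝ :=
  (1 / 4) * Real.exp 1 * (Real.Gamma ((α + 1) / β) / Real.Gamma ((α + 3) / β)) *
    (2 / β * (1 + symGammaTheta α β / (2 * symGammaK0 α β))) ^ (2 / β)

/-- The threshold `G`. -/
noncomputable def symGammaG (α β : ℝ) : ℝ :=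
  (max 1 (symGammaG1 α β) * symGammaG2 α β) ^ (β / (β - 2))

/-!
Write `u = (α + 1) / β` and `s = 2 / β < 1`. The even moments of the law are
`E γ²ᵏ = Γ(u + k s) / Γ(u)`, and the claim follows by comparing the power series of
`E cosh (t γ) = E exp (t γ)` term by term with that of `exp (t² Var(γ) / 2)`, once
`E γ²ᵏ ≤ (2 k)! / (2ᵏ k!) (E γ²)ᵏ` for all `k`, that is `ζ(k) ≤ 1`, is known
(`isStrictlySubgaussian_id_of_moments`).

All these inequalities follow from the one for `k = 2`, the kurtosis bound. The reason is that
`x ↦ Γ(x + s) / Γ(x)` is concave on `[0, ∞)` (`concaveOn_gamma_add_div_gamma`): an integration by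
parts in a Beta integral turns it into
`s / Γ(1 - s) · ∫₀¹ (1 - tˣ) tˢ⁻¹ (1 - t)⁻ˢ⁻¹ dt`, whose integrand is concave in `x`. Hence the
ratios of consecutive even moments `q j = Γ(u + (j + 1) s) / Γ(u + j s)` form a concave sequence;
since `q 1 ≤ 3 q 0` is the kurtosis bound, `q j ≤ (2 j + 1) q 0` for all `j`, and multiplying these
gives the moment inequalities (`gamma_moment_le_of_kurtosis`).

The kurtosis bound itself (`symGamma_kurtosis`) is automatic for `α ≥ 0`, again by concavity. For
`α < 0`, its failure would force `G > 2` (`two_lt_symGammaG`), and then `ζ(2) ≤ 1`, which is the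
kurtosis bound, is among the hypotheses.
-/

/-! ### Concavity of a ratio of Gamma functions -/

open Real Set intervalIntegral in
lemma intervalIntegrable_rpow_mul_one_sub_rpow {a b : ℝ} (ha : 0 < a) (hb : 0 < b) :
    IntervalIntegrable (fun t : ℝ => t ^ (a - 1) * (1 - t) ^ (b - 1)) volume 0 1 := by
  have h := Complex.betaIntegral_convergent (u := a) (v := b) (by simpa) (by simpa)
  rw [intervalIntegrable_iff_integrableOn_Ioc_of_le zero_le_one] at h ⊢
  refine (IntegrableOn.congr_fun h.re (fun t ht => ?_) measurableSet_Ioc)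
  have : ((t : ℂ) ^ ((a : ℂ) - 1) * (1 - (t : ℂ)) ^ ((b : ℂ) - 1)) =
      ((t ^ (a - 1) * (1 - t) ^ (b - 1) : ℝ) : ℂ) := by
    push_cast
    rw [Complex.ofReal_cpow ht.1.le, Complex.ofReal_cpow (by linarith [ht.2])]
    push_cast; rfl
  simp only [this]
  rfl

open Real Set intervalIntegral in
lemma integral_rpow_mul_one_sub_rpow {a b : ℝ} (ha : 0 < a) (hb : 0 < b) :
    ∫ t in (0 : ℝ)..1, t ^ (a - 1) * (1 - t) ^ (b - 1) = beta a b := by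
  rw [beta_eq_betaIntegralReal a b ha hb, Complex.betaIntegral]
  rw [integral_congr (g := fun t : ℝ => ((t ^ (a - 1) * (1 - t) ^ (b - 1) : ℝ) : ℂ))]
  · rw [intervalIntegral.integral_ofReal, Complex.ofReal_re]
  · intro t ht
    rw [uIcc_of_le zero_le_one] at ht
    simp only
    push_cast
    rw [Complex.ofReal_cpow ht.1, Complex.ofReal_cpow (by linarith [ht.2])]
    push_cast; rfl

lemma one_sub_rpow_le_max_mul {x t : ℝ} (ht0 : 0 ≤ t) (ht1 : t ≤ 1) (hx : 0 ≤ x) :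
    1 - t ^ x ≤ max 1 x * (1 - t) := by
  rcases le_total 1 x with h | h
  · rw [max_eq_right h]
    have := one_add_mul_self_le_rpow_one_add (s := t - 1) (by linarith) h
    rw [show 1 + (t - 1) = t by ring] at this
    linarith
  · rw [max_eq_left h]
    have : t ^ (1 : ℝ) ≤ t ^ x := by
      rcases ht0.eq_or_lt with rfl | h0
      · rcases hx.eq_or_lt with rfl | hx0
        · simp
        · rw [Real.zero_rpow hx0.ne', Real.zero_rpow one_ne_zero]
      · exact Real.rpow_le_rpow_of_exponent_ge h0 ht1 h
    rw [Real.rpow_one] at this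
    linarith

/-- The kernel `(1 - tˣ) tˢ⁻¹ (1 - t)⁻ˢ⁻¹` representing `x ↦ Γ(x + s) / Γ(x)`. It is concave in `x`
for each `t`. -/
noncomputable def gammaRatioKernel (s x t : ℝ) : ℝ :=
  (1 - t ^ x) * (t ^ (s - 1) * (1 - t) ^ (-s - 1))

open Set in
/-- The zero of `1 - tˣ` at `t = 1` lowers the order of the singularity there by one, so that the
kernel is dominated by an integrable Beta density. -/
lemma intervalIntegrable_gammaRatioKernel {s x : ℝ} (hs0 : 0 < s) (hs1 : s < 1) (hx : 0 ≤ x) :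
    IntervalIntegrable (gammaRatioKernel s x) volume 0 1 := by
  have h := (intervalIntegrable_rpow_mul_one_sub_rpow hs0 (sub_pos.2 hs1)).const_mul (max 1 x)
  rw [intervalIntegrable_iff_integrableOn_Ioo_of_le zero_le_one] at h ⊢
  refine Integrable.mono' h ?_ ?_
  · unfold gammaRatioKernel
    exact Measurable.aestronglyMeasurable (by fun_prop)
  · refine (ae_restrict_iff' measurableSet_Ioo).2 (Filter.Eventually.of_forall fun t ht => ?_)
    have h1 : 0 ≤ 1 - t ^ x := by linarith [Real.rpow_le_one ht.1.le ht.2.le hx]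
    have h2 : 0 < 1 - t := by linarith [ht.2]
    have h3 : 0 < t := ht.1
    rw [Real.norm_of_nonneg (by unfold gammaRatioKernel; positivity)]
    calc gammaRatioKernel s x t
        ≤ (max 1 x * (1 - t)) * (t ^ (s - 1) * (1 - t) ^ (-s - 1)) := by
          unfold gammaRatioKernel
          gcongr
          exact one_sub_rpow_le_max_mul h3.le ht.2.le hx
      _ = max 1 x * (t ^ (s - 1) * (1 - t) ^ (1 - s - 1)) := by
          rw [show (1 - s - 1 : ℝ) = (-s - 1) + 1 by ring, Real.rpow_add_one h2.ne']
          ring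

open Set Filter Topology in
lemma continuousOn_one_sub_rpow_mul {s x : ℝ} (hs0 : 0 < s) (hs1 : s < 1) (hx : 0 < x) :
    ContinuousOn (fun t : ℝ => (1 - t ^ x) * (t ^ s * (1 - t) ^ (-s))) (Icc 0 1) := by
  intro t ht
  rcases ht.2.eq_or_lt with rfl | h1
  · unfold ContinuousWithinAt
    simp only [Real.one_rpow, sub_self, zero_mul]
    have hlim : Tendsto (fun t : ℝ => max 1 x * (1 - t) ^ (1 - s)) (𝓝[Icc 0 1] 1) (𝓝 0) := by
      have : ContinuousAt (fun t : ℝ => max 1 x * (1 - t) ^ (1 - s)) 1 :=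
        ContinuousAt.mul continuousAt_const
          (ContinuousAt.rpow_const (by fun_prop) (Or.inr (by linarith)))
      have h := this.tendsto
      rw [sub_self, Real.zero_rpow (by linarith), mul_zero] at h
      exact h.mono_left nhdsWithin_le_nhds
    refine squeeze_zero' ?_ ?_ hlim
    · filter_upwards [self_mem_nhdsWithin] with t ht
      have h1 : 0 ≤ 1 - t ^ x := by linarith [Real.rpow_le_one ht.1 ht.2 hx.le]
      have h2 : 0 ≤ 1 - t := by linarith [ht.2]
      have h3 : 0 ≤ t := ht.1
      positivity
    · filter_upwards [self_mem_nhdsWithin] with t ht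
      rcases ht.2.eq_or_lt with rfl | h1
      · simp [Real.zero_rpow (show 1 - s ≠ 0 by linarith)]
      have h2 : 0 < 1 - t := by linarith
      have h3 : 0 ≤ t := ht.1
      have h4 : 0 ≤ max 1 x := le_max_of_le_left zero_le_one
      calc (1 - t ^ x) * (t ^ s * (1 - t) ^ (-s))
          ≤ (max 1 x * (1 - t)) * (1 * (1 - t) ^ (-s)) := by
            gcongr
            · exact one_sub_rpow_le_max_mul h3 ht.2 hx.le
            · exact Real.rpow_le_one h3 ht.2 hs0.le
        _ = max 1 x * (1 - t) ^ (1 - s) := by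
            rw [show (1 - s : ℝ) = (-s) + 1 by ring, Real.rpow_add_one h2.ne']
            ring
  · refine ContinuousAt.continuousWithinAt ?_
    refine ContinuousAt.mul ?_ (ContinuousAt.mul ?_ ?_)
    · exact continuousAt_const.sub (Real.continuousAt_rpow_const _ _ (Or.inr hx.le))
    · exact Real.continuousAt_rpow_const _ _ (Or.inr hs0.le)
    · exact ContinuousAt.rpow_const (by fun_prop) (Or.inl (by linarith))

open Set in
/-- Integration by parts in `x B(x + s, 1 - s)`, with primitive `tˣ - 1` of `x tˣ⁻¹`. -/
lemma mul_beta_eq_integral_gammaRatioKernel {s x : ℝ} (hs0 : 0 < s) (hs1 : s < 1) (hx : 0 < x) :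
    x * beta (x + s) (1 - s) = s * ∫ t in (0 : ℝ)..1, gammaRatioKernel s x t := by
  have hxs : 0 < x + s := by linarith
  have h1s : 0 < 1 - s := by linarith
  have hi1 := (intervalIntegrable_gammaRatioKernel hs0 hs1 hx.le).const_mul s
  have hi2 := (intervalIntegrable_rpow_mul_one_sub_rpow hxs h1s).const_mul x
  have key := intervalIntegral.integral_eq_sub_of_hasDerivAt_of_le zero_le_one
    (continuousOn_one_sub_rpow_mul hs0 hs1 hx)
    (f' := fun t => s * gammaRatioKernel s x t - x * (t ^ (x + s - 1) * (1 - t) ^ (1 - s - 1)))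
    (fun t ht => ?_) (hi1.sub hi2)
  · rw [intervalIntegral.integral_sub hi1 hi2, intervalIntegral.integral_const_mul,
      intervalIntegral.integral_const_mul, integral_rpow_mul_one_sub_rpow hxs h1s] at key
    simp only [Real.one_rpow, sub_self, zero_mul, Real.zero_rpow hs0.ne', mul_zero] at key
    linarith
  · have h2 : 0 < 1 - t := by linarith [ht.2]
    have h3 : 0 < t := ht.1
    have d1 := (Real.hasDerivAt_rpow_const (x := t) (p := x) (Or.inl h3.ne')).const_sub 1
    have d2 := Real.hasDerivAt_rpow_const (x := t) (p := s) (Or.inl h3.ne')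
    have d3 := ((hasDerivAt_id t).const_sub 1).rpow_const (p := -s) (Or.inl h2.ne')
    refine (d1.mul (d2.mul d3)).congr_deriv ?_
    simp only [id, gammaRatioKernel, Pi.mul_apply]
    rw [show x + s - 1 = (x - 1) + s by ring, Real.rpow_add h3,
      show 1 - s - 1 = -s by ring, show -s = (-s - 1) + 1 by ring, Real.rpow_add_one h2.ne',
      show t ^ s = t ^ (s - 1) * t by rw [← Real.rpow_add_one h3.ne', sub_add_cancel]]
    rw [show -s - 1 + 1 - 1 = -s - 1 by ring]
    ring

/-- At `x = 0` both sides vanish: `Real.Gamma 0 = 0` gives the value `0` to the quotient, which is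
also the limit of `Γ(x + s) / Γ(x)` as `x → 0`. -/
lemma gamma_add_div_gamma_eq_integral {s x : ℝ} (hs0 : 0 < s) (hs1 : s < 1) (hx : 0 ≤ x) :
    Real.Gamma (x + s) / Real.Gamma x =
      s / Real.Gamma (1 - s) * ∫ t in (0 : ℝ)..1, gammaRatioKernel s x t := by
  rcases hx.eq_or_lt with rfl | hx
  · simp [gammaRatioKernel, Real.Gamma_zero]
  have h := mul_beta_eq_integral_gammaRatioKernel hs0 hs1 hx
  rw [beta, show x + s + (1 - s) = x + 1 by ring, Real.Gamma_add_one hx.ne'] at h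
  have h1 := (Real.Gamma_pos_of_pos hx).ne'
  have h2 := (Real.Gamma_pos_of_pos (sub_pos.2 hs1)).ne'
  rw [div_mul_eq_mul_div, ← h]
  field_simp

open Set in
lemma concaveOn_gammaRatioKernel (s : ℝ) {t : ℝ} (ht0 : 0 < t) (ht1 : t < 1) :
    ConcaveOn ℝ (Ici 0) (fun x => gammaRatioKernel s x t) := by
  refine ⟨convex_Ici 0, fun x _ y _ a b ha hb hab => ?_⟩
  have hc := (convexOn_exp).2 (mem_univ (Real.log t * x)) (mem_univ (Real.log t * y)) ha hb hab
  have hw : 0 ≤ t ^ (s - 1) * (1 - t) ^ (-s - 1) := by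
    have : 0 < 1 - t := by linarith
    positivity
  simp only [smul_eq_mul, gammaRatioKernel, Real.rpow_def_of_pos ht0] at hc hw ⊢
  rw [show a * (Real.log t * x) + b * (Real.log t * y) = Real.log t * (a * x + b * y) by ring] at hc
  nlinarith [mul_le_mul_of_nonneg_right hc hw]

open Set in
/-- For `0 < s < 1` the function `x ↦ Γ(x + s) / Γ(x)` is concave on `[0, ∞)`. -/
theorem concaveOn_gamma_add_div_gamma {s : ℝ} (hs0 : 0 < s) (hs1 : s < 1) :
    ConcaveOn ℝ (Ici 0) (fun x => Real.Gamma (x + s) / Real.Gamma x) := by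
  refine ⟨convex_Ici 0, fun x hx y hy a b ha hb hab => ?_⟩
  have hx' : 0 ≤ x := hx
  have hy' : 0 ≤ y := hy
  have hz : 0 ≤ a * x + b * y := by positivity
  simp only [smul_eq_mul]
  rw [gamma_add_div_gamma_eq_integral hs0 hs1 hx', gamma_add_div_gamma_eq_integral hs0 hs1 hy',
    gamma_add_div_gamma_eq_integral hs0 hs1 hz]
  have ix := (intervalIntegrable_gammaRatioKernel hs0 hs1 hx').const_mul a
  have iy := (intervalIntegrable_gammaRatioKernel hs0 hs1 hy').const_mul b
  have key := intervalIntegral.integral_mono_on_of_le_Ioo zero_le_one (ix.add iy)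
    (intervalIntegrable_gammaRatioKernel hs0 hs1 hz)
    (fun t ht => (concaveOn_gammaRatioKernel s ht.1 ht.2).2 hx hy ha hb hab)
  rw [intervalIntegral.integral_add ix iy, intervalIntegral.integral_const_mul,
    intervalIntegral.integral_const_mul] at key
  have hc : 0 ≤ s / Real.Gamma (1 - s) :=
    div_nonneg hs0.le (Real.Gamma_pos_of_pos (sub_pos.2 hs1)).le
  linarith [mul_le_mul_of_nonneg_left key hc]

/-! ### Moment inequalities from the kurtosis bound -/

open Set in
/-- If `q j = Γ(u + (j + 1) s) / Γ(u + j s)` satisfies `q 1 ≤ 3 q 0`, then the concave function `q`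
stays below the line `(2 j + 1) q 0`. -/
lemma gamma_ratio_le_of_kurtosis {u s : ℝ} (hu : 0 < u) (hs0 : 0 < s) (hs1 : s < 1)
    (h : Real.Gamma (u + 2 * s) / Real.Gamma (u + s) ≤
      3 * (Real.Gamma (u + s) / Real.Gamma u)) (j : ℕ) :
    Real.Gamma (u + (j + 1) * s) / Real.Gamma (u + j * s) ≤
      (2 * j + 1) * (Real.Gamma (u + s) / Real.Gamma u) := by
  rcases Nat.eq_zero_or_pos j with rfl | hj
  · simp
  have hj1 : (1 : ℝ) ≤ j := by exact_mod_cast hj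
  have hj0 : (0 : ℝ) < j := by linarith
  have hc := (concaveOn_gamma_add_div_gamma hs0 hs1).2 (show u ∈ Ici 0 from hu.le)
    (show u + j * s ∈ Ici 0 from mem_Ici.2 (by positivity))
    (show 0 ≤ 1 - 1 / (j : ℝ) by rw [sub_nonneg, div_le_one hj0]; exact hj1)
    (show 0 ≤ 1 / (j : ℝ) by positivity) (by ring)
  simp only [smul_eq_mul] at hc
  rw [show (1 - 1 / (j : ℝ)) * u + 1 / j * (u + j * s) = u + s by field_simp; ring,
    show u + s + s = u + 2 * s by ring, show u + j * s + s = u + (j + 1) * s by ring] at hc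
  have h2 := mul_le_mul_of_nonneg_left (hc.trans h) hj0.le
  have e : ∀ X Y : ℝ, (j : ℝ) * ((1 - 1 / j) * X + 1 / j * Y) = (j - 1) * X + Y := by
    intro X Y; field_simp
  rw [e] at h2
  linarith

/-- The moments `Γ(u + k s) / Γ(u)` are bounded by the Gaussian ones with the same variance. -/
lemma gamma_moment_le_of_kurtosis {u s : ℝ} (hu : 0 < u) (hs0 : 0 < s) (hs1 : s < 1)
    (h : Real.Gamma (u + 2 * s) / Real.Gamma (u + s) ≤
      3 * (Real.Gamma (u + s) / Real.Gamma u)) (k : ℕ) :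
    Real.Gamma (u + k * s) / Real.Gamma u ≤
      ((2 * k).factorial : ℝ) / (2 ^ k * (k.factorial : ℝ)) *
        (Real.Gamma (u + s) / Real.Gamma u) ^ k := by
  have hG : ∀ j : ℕ, 0 < Real.Gamma (u + j * s) := fun j => Real.Gamma_pos_of_pos (by positivity)
  have hG0 : 0 < Real.Gamma u := Real.Gamma_pos_of_pos hu
  have hG1 : 0 < Real.Gamma (u + s) := Real.Gamma_pos_of_pos (by positivity)
  induction k with
  | zero => simp [hG0.ne']
  | succ k ih =>
    have hq := gamma_ratio_le_of_kurtosis hu hs0 hs1 h k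
    have hp := hG (k + 1)
    push_cast at hp ⊢
    calc Real.Gamma (u + (k + 1) * s) / Real.Gamma u
        = Real.Gamma (u + (k + 1) * s) / Real.Gamma (u + k * s) *
            (Real.Gamma (u + k * s) / Real.Gamma u) := by
          have := (hG k).ne'
          field_simp
      _ ≤ ((2 * k + 1) * (Real.Gamma (u + s) / Real.Gamma u)) *
            (((2 * k).factorial : ℝ) / (2 ^ k * (k.factorial : ℝ)) *
              (Real.Gamma (u + s) / Real.Gamma u) ^ k) := by
          have := hG k
          gcongr
      _ = _ := by
          rw [show 2 * (k + 1) = 2 * k + 1 + 1 by ring, Nat.factorial_succ (2 * k + 1),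
            Nat.factorial_succ (2 * k), Nat.factorial_succ k]
          push_cast
          have : (k.factorial : ℝ) ≠ 0 := by positivity
          rw [pow_succ, pow_succ]
          field_simp
          ring

/-- A concave function vanishing at `0` satisfies `f (u + s) ≤ (1 + s / u) f u`, and `s / u ≤ 2`. -/
lemma gamma_kurtosis_of_le {u s : ℝ} (hs0 : 0 < s) (hs1 : s < 1) (hsu : s ≤ 2 * u) :
    Real.Gamma (u + 2 * s) / Real.Gamma (u + s) ≤ 3 * (Real.Gamma (u + s) / Real.Gamma u) := by
  have hu : 0 < u := by linarith
  have hc := (concaveOn_gamma_add_div_gamma hs0 hs1).2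
    (show u + s ∈ Set.Ici 0 from Set.mem_Ici.2 (by positivity)) Set.self_mem_Ici
    (show 0 ≤ u / (u + s) by positivity) (show 0 ≤ s / (u + s) by positivity) (by field_simp)
  simp only [smul_eq_mul, Real.Gamma_zero, div_zero, mul_zero, add_zero] at hc
  rw [div_mul_cancel₀ u (by positivity), show u + s + s = u + 2 * s by ring] at hc
  have h1 : 1 / 3 ≤ u / (u + s) := by
    rw [div_le_div_iff₀ (by norm_num) (by positivity)]; linarith
  have h2 : 0 ≤ Real.Gamma (u + 2 * s) / Real.Gamma (u + s) :=
    div_nonneg (Real.Gamma_pos_of_pos (by positivity)).le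
      (Real.Gamma_pos_of_pos (by positivity)).le
  linarith [mul_le_mul_of_nonneg_right h1 h2]

/-! ### The kurtosis bound and the threshold -/

lemma gamma_add_le_gamma_mul_rpow {x s : ℝ} (hx : 0 < x) (hs0 : 0 < s) (hs1 : s < 1) :
    Real.Gamma (x + s) ≤ Real.Gamma x * x ^ s := by
  have h := Real.Gamma_mul_add_mul_le_rpow_Gamma_mul_rpow_Gamma hx (show 0 < x + 1 by linarith)
    (sub_pos.2 hs1) hs0 (by ring)
  have hG := Real.Gamma_pos_of_pos hx
  rw [show (1 - s) * x + s * (x + 1) = x + s by ring, Real.Gamma_add_one hx.ne',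
    Real.mul_rpow hx.le hG.le, mul_left_comm, ← Real.rpow_add hG, sub_add_cancel,
    Real.rpow_one, mul_comm] at h
  exact h

/-- If the kurtosis exceeds `3`, then log-convexity of `Γ` bounds `Γ(u) / Γ(u + s)` from below, and
with `3 e / 4 > 2` the threshold exceeds `2`. -/
lemma two_lt_symGammaG {α β : ℝ} (hα : -1 < α) (hα1 : α ≤ 1) (hβ : 2 < β)
    (h : 3 * (Real.Gamma ((α + 3) / β) / Real.Gamma ((α + 1) / β)) <
      Real.Gamma ((α + 5) / β) / Real.Gamma ((α + 3) / β)) :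
    2 < symGammaG α β := by
  have hβ0 : 0 < β := by linarith
  have hθ : symGammaTheta α β = 1 := max_eq_right (by linarith)
  have hk : 1 ≤ symGammaK0 α β := le_max_left _ _
  have hA : 0 < Real.Gamma ((α + 1) / β) :=
    Real.Gamma_pos_of_pos (div_pos (by linarith) hβ0)
  have hy : 0 < (α + 3) / β := div_pos (by linarith) hβ0
  have hB : 0 < Real.Gamma ((α + 3) / β) := Real.Gamma_pos_of_pos hy
  have hs0 : 0 < 2 / β := by positivity
  have hs1 : 2 / β < 1 := by rw [div_lt_one hβ0]; exact hβ
  have hC := gamma_add_le_gamma_mul_rpow hy hs0 hs1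
  rw [← add_div, show α + 3 + 2 = α + 5 by ring] at hC
  set s := 2 / β with hs
  have hR : 3 < Real.Gamma ((α + 1) / β) / Real.Gamma ((α + 3) / β) * ((α + 3) / β) ^ s := by
    have h1 : 3 * (Real.Gamma ((α + 3) / β) / Real.Gamma ((α + 1) / β)) < ((α + 3) / β) ^ s :=
      h.trans_le (by rwa [div_le_iff₀' hB])
    rw [← mul_div_assoc, div_lt_iff₀ hA] at h1
    rw [div_mul_eq_mul_div, lt_div_iff₀ hB]
    linarith
  have hW : (α + 3) / β / 2 ≤ s * (1 + symGammaTheta α β / (2 * symGammaK0 α β)) := by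
    have h1 : (α + 3) / β / 2 ≤ s := by
      rw [hs, div_div, div_le_div_iff₀ (by positivity) hβ0]
      nlinarith
    have h2 : 0 ≤ symGammaTheta α β / (2 * symGammaK0 α β) := by
      rw [hθ]; positivity
    nlinarith
  have hG2 : (2 : ℝ) ^ (1 - s) < symGammaG2 α β := by
    have h2s : (0 : ℝ) < 2 ^ s := by positivity
    calc (2 : ℝ) ^ (1 - s) = 2 / 2 ^ s := by rw [Real.rpow_sub two_pos, Real.rpow_one]
      _ < 1 / 4 * Real.exp 1 * 3 / 2 ^ s := by
        gcongr
        linarith [Real.exp_one_gt_d9]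
      _ ≤ 1 / 4 * Real.exp 1 * (Real.Gamma ((α + 1) / β) / Real.Gamma ((α + 3) / β) *
            ((α + 3) / β) ^ s) / 2 ^ s := by gcongr
      _ = 1 / 4 * Real.exp 1 * (Real.Gamma ((α + 1) / β) / Real.Gamma ((α + 3) / β)) *
            ((α + 3) / β / 2) ^ s := by
        rw [Real.div_rpow hy.le two_pos.le]; ring
      _ ≤ symGammaG2 α β := by
        unfold symGammaG2
        gcongr
  have hG2pos : 0 < symGammaG2 α β := lt_trans (by positivity) hG2
  have he : (1 - s) * (β / (β - 2)) = 1 := by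
    have : β - 2 ≠ 0 := by linarith
    rw [hs]; field_simp
  have hexp : 0 < β / (β - 2) := div_pos hβ0 (by linarith)
  calc (2 : ℝ) = ((2 : ℝ) ^ (1 - s)) ^ (β / (β - 2)) := by
        rw [← Real.rpow_mul two_pos.le, he, Real.rpow_one]
    _ < symGammaG2 α β ^ (β / (β - 2)) := Real.rpow_lt_rpow (by positivity) hG2 hexp
    _ ≤ symGammaG α β := by
        unfold symGammaG
        refine Real.rpow_le_rpow hG2pos.le ?_ hexp.le
        exact le_mul_of_one_le_left hG2pos.le (le_max_left _ _)

lemma symGammaZeta_two (α β : ℝ) :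
    symGammaZeta α β 2 = Real.Gamma ((α + 5) / β) * Real.Gamma ((α + 1) / β) /
      (3 * Real.Gamma ((α + 3) / β) ^ 2) := by
  have h1 : ((2 : ℕ) : ℤ) - 1 = 1 := by norm_num
  rw [symGammaZeta, h1, zpow_one, show α + 2 * ((2 : ℕ) : ℝ) + 1 = α + 5 by push_cast; ring,
    show Nat.factorial (2 * 2) = 24 from rfl, show Nat.factorial 2 = 2 from rfl]
  push_cast
  rw [div_eq_mul_inv _ (3 * _), mul_inv]
  ring

/-- The kurtosis bound `E γ⁴ ≤ 3 (E γ²)²` holds outright for `α ≥ 0`, and for `α < 0` the threshold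
is large enough for the hypothesis to contain it. -/
lemma symGamma_kurtosis {α β : ℝ} (hα : -1 < α) (hβ : 2 < β)
    (hζ : ∀ k : ℕ, (k : ℝ) < symGammaG α β → symGammaZeta α β k ≤ 1) :
    Real.Gamma ((α + 5) / β) / Real.Gamma ((α + 3) / β) ≤
      3 * (Real.Gamma ((α + 3) / β) / Real.Gamma ((α + 1) / β)) := by
  have hβ0 : 0 < β := by linarith
  rcases le_or_gt 0 α with h0 | h0
  · have h := gamma_kurtosis_of_le (u := (α + 1) / β) (s := 2 / β) (by positivity)
      (by rw [div_lt_one hβ0]; exact hβ)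
      (by rw [← mul_div_assoc]; gcongr; linarith)
    rwa [← mul_div_assoc, ← add_div, ← add_div, show α + 1 + 2 * 2 = α + 5 by ring,
      show α + 1 + 2 = α + 3 by ring] at h
  · by_contra! hlt
    have h2 := hζ 2 (by exact_mod_cast two_lt_symGammaG hα (by linarith) hβ hlt)
    have hA : 0 < Real.Gamma ((α + 1) / β) := Real.Gamma_pos_of_pos (div_pos (by linarith) hβ0)
    have hB : 0 < Real.Gamma ((α + 3) / β) := Real.Gamma_pos_of_pos (div_pos (by linarith) hβ0)
    rw [symGammaZeta_two, div_le_one (by positivity)] at h2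
    rw [← mul_div_assoc, div_lt_div_iff₀ hA hB] at hlt
    nlinarith

lemma symGamma_moment_le {α β : ℝ} (hα : -1 < α) (hβ : 2 < β)
    (hζ : ∀ k : ℕ, (k : ℝ) < symGammaG α β → symGammaZeta α β k ≤ 1) (k : ℕ) :
    Real.Gamma ((α + 2 * k + 1) / β) / Real.Gamma ((α + 1) / β) ≤
      ((2 * k).factorial : ℝ) / (2 ^ k * (k.factorial : ℝ)) *
        (Real.Gamma ((α + 3) / β) / Real.Gamma ((α + 1) / β)) ^ k := by
  have hβ0 : 0 < β := by linarith
  have e1 : (α + 1) / β + 2 / β = (α + 3) / β := by ring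
  have e2 : (α + 1) / β + 2 * (2 / β) = (α + 5) / β := by ring
  have e3 : (α + 1) / β + k * (2 / β) = (α + 2 * k + 1) / β := by ring
  have h := gamma_moment_le_of_kurtosis (u := (α + 1) / β) (s := 2 / β)
    (div_pos (by linarith) hβ0) (by positivity) (by rw [div_lt_one hβ0]; exact hβ)
    (by rw [e1, e2]; exact symGamma_kurtosis hα hβ hζ) k
  rwa [e1, e3] at h

/-! ### Symmetric laws with sub-Gaussian even moments -/

lemma lintegral_ofReal_cosh_le {μ : Measure ℝ} {v : ℝ} (hv : 0 ≤ v)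
    (hm : ∀ k : ℕ, ∫⁻ x, ENNReal.ofReal (x ^ (2 * k)) ∂μ ≤
      ENNReal.ofReal (((2 * k).factorial : ℝ) / (2 ^ k * (k.factorial : ℝ)) * v ^ k)) (t : ℝ) :
    ∫⁻ x, ENNReal.ofReal (Real.cosh (t * x)) ∂μ ≤ ENNReal.ofReal (Real.exp (t ^ 2 * v / 2)) := by
  have hnn : ∀ (n : ℕ) (y : ℝ), 0 ≤ y ^ (2 * n) := fun n y => by rw [pow_mul]; positivity
  have h1 : ∀ x : ℝ, ENNReal.ofReal (Real.cosh (t * x)) =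
      ∑' n : ℕ, ENNReal.ofReal (t ^ (2 * n) / ((2 * n).factorial : ℝ)) *
        ENNReal.ofReal (x ^ (2 * n)) := by
    intro x
    rw [Real.cosh_eq_tsum, ENNReal.ofReal_tsum_of_nonneg
      (fun n => div_nonneg (hnn n _) (by positivity)) (Real.hasSum_cosh _).summable]
    congr with n
    rw [← ENNReal.ofReal_mul (div_nonneg (hnn n _) (by positivity)), mul_pow]
    congr 1
    ring
  simp_rw [h1]
  have hexp := NormedSpace.expSeries_div_hasSum_exp (t ^ 2 * v / 2)
  rw [← Real.exp_eq_exp_ℝ] at hexp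
  rw [lintegral_tsum (fun n => by fun_prop), ← hexp.tsum_eq,
    ENNReal.ofReal_tsum_of_nonneg (fun n => by positivity) hexp.summable]
  refine ENNReal.tsum_le_tsum fun n => ?_
  rw [lintegral_const_mul _ (by fun_prop)]
  refine (mul_le_mul_right (hm n) _).trans_eq ?_
  rw [← ENNReal.ofReal_mul (div_nonneg (hnn n _) (by positivity))]
  congr 1
  rw [div_pow, mul_pow, ← pow_mul]
  field_simp

lemma lintegral_ofReal_exp_eq_cosh {μ : Measure ℝ}
    (hneg : MeasurePreserving (fun x : ℝ => -x) μ μ) (t : ℝ) :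
    ∫⁻ x, ENNReal.ofReal (Real.exp (t * x)) ∂μ = ∫⁻ x, ENNReal.ofReal (Real.cosh (t * x)) ∂μ := by
  have h : ∫⁻ x, ENNReal.ofReal (Real.exp (-(t * x))) ∂μ =
      ∫⁻ x, ENNReal.ofReal (Real.exp (t * x)) ∂μ := by
    rw [← hneg.lintegral_comp (f := fun x => ENNReal.ofReal (Real.exp (t * x))) (by fun_prop)]
    simp
  have h2 : ∫⁻ x, ENNReal.ofReal (Real.cosh (t * x)) ∂μ = ENNReal.ofReal (1 / 2) *
      (∫⁻ x, ENNReal.ofReal (Real.exp (t * x)) ∂μ +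
        ∫⁻ x, ENNReal.ofReal (Real.exp (-(t * x))) ∂μ) := by
    rw [← lintegral_add_left (by fun_prop), ← lintegral_const_mul _ (by fun_prop)]
    refine lintegral_congr fun x => ?_
    rw [← ENNReal.ofReal_add (Real.exp_pos _).le (Real.exp_pos _).le,
      ← ENNReal.ofReal_mul (by norm_num), Real.cosh_eq]
    congr 1
    ring
  rw [h2, h, ← two_mul, ← mul_assoc, ← ENNReal.ofReal_ofNat 2,
    ← ENNReal.ofReal_mul (by norm_num)]
  norm_num

/-- A symmetric law whose even moments are at most those of the centered Gaussian law of variance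
`v` has a moment generating function at most `exp (t² v / 2)`. -/
lemma integrable_exp_and_integral_le_of_moments {μ : Measure ℝ} {v : ℝ}
    (hneg : MeasurePreserving (fun x : ℝ => -x) μ μ) (hv : 0 ≤ v)
    (hm : ∀ k : ℕ, ∫⁻ x, ENNReal.ofReal (x ^ (2 * k)) ∂μ ≤
      ENNReal.ofReal (((2 * k).factorial : ℝ) / (2 ^ k * (k.factorial : ℝ)) * v ^ k)) (t : ℝ) :
    Integrable (fun x => Real.exp (t * x)) μ ∧
      ∫ x, Real.exp (t * x) ∂μ ≤ Real.exp (t ^ 2 * v / 2) := by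
  have h : ∫⁻ x, ENNReal.ofReal (Real.exp (t * x)) ∂μ ≤ ENNReal.ofReal (Real.exp (t ^ 2 * v / 2)) :=
    (lintegral_ofReal_exp_eq_cosh hneg t).trans_le (lintegral_ofReal_cosh_le hv hm t)
  have hnn : ∀ x : ℝ, 0 ≤ Real.exp (t * x) := fun x => (Real.exp_pos _).le
  have hmeas : AEStronglyMeasurable (fun x : ℝ => Real.exp (t * x)) μ :=
    Measurable.aestronglyMeasurable (by fun_prop)
  refine ⟨⟨hmeas, ?_⟩, ?_⟩
  · rw [hasFiniteIntegral_iff_ofReal (Filter.Eventually.of_forall hnn)]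
    exact h.trans_lt ENNReal.ofReal_lt_top
  · rw [integral_eq_lintegral_of_nonneg_ae (Filter.Eventually.of_forall hnn) hmeas]
    exact ENNReal.toReal_le_of_le_ofReal (Real.exp_pos _).le h

lemma isStrictlySubgaussian_id_of_moments {μ : Measure ℝ} [IsProbabilityMeasure μ] {v : ℝ}
    (hneg : MeasurePreserving (fun x : ℝ => -x) μ μ) (hv : 0 ≤ v)
    (h2 : ∫⁻ x, ENNReal.ofReal (x ^ 2) ∂μ = ENNReal.ofReal v)
    (hm : ∀ k : ℕ, ∫⁻ x, ENNReal.ofReal (x ^ (2 * k)) ∂μ ≤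
      ENNReal.ofReal (((2 * k).factorial : ℝ) / (2 ^ k * (k.factorial : ℝ)) * v ^ k)) :
    IsStrictlySubgaussian (fun x : ℝ => x) μ := by
  have hmgf := integrable_exp_and_integral_le_of_moments hneg hv hm
  have hset : integrableExpSet (fun x : ℝ => x) μ = Set.univ :=
    Set.eq_univ_of_forall fun t => (hmgf t).1
  have hint : Integrable (fun x : ℝ => x) μ :=
    integrable_of_mem_interior_integrableExpSet (by simp [hset])
  have hzero : ∫ x, x ∂μ = 0 := by
    have h : ∫ x, -x ∂μ = ∫ x, x ∂μ :=
      hneg.integral_comp (Homeomorph.neg ℝ).measurableEmbedding (fun x => x)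
    rw [integral_neg] at h
    linarith
  have hvar : variance (fun x : ℝ => x) μ = v := by
    rw [variance_of_integral_eq_zero aemeasurable_id' hzero,
      integral_eq_lintegral_of_nonneg_ae (Filter.Eventually.of_forall fun x => sq_nonneg x)
        (Measurable.aestronglyMeasurable (by fun_prop)), h2, ENNReal.toReal_ofReal hv]
  refine ⟨⟨hint, hzero, √v, Real.sqrt_nonneg v, fun t => ?_⟩, fun t => ?_⟩
  · rw [Real.sq_sqrt hv]
    exact hmgf t
  · rw [hvar]
    exact (hmgf t).2

/-! ### Moments of the symmetrized generalized gamma law -/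

lemma measurable_symGammaDensity (α β : ℝ) : Measurable (symGammaDensity α β) := by
  unfold symGammaDensity
  fun_prop

lemma measurePreserving_neg_symGammaLaw (α β : ℝ) :
    MeasurePreserving (fun x : ℝ => -x) (symGammaLaw α β) (symGammaLaw α β) := by
  refine ⟨measurable_neg, Measure.ext fun s hs => ?_⟩
  have hs' : MeasurableSet ((fun x : ℝ => -x) ⁻¹' s) := measurable_neg hs
  rw [Measure.map_apply measurable_neg hs, symGammaLaw, withDensity_apply _ hs,
    withDensity_apply _ hs',
    ← (Measure.measurePreserving_neg (volume : Measure ℝ)).setLIntegral_comp_preimage hs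
      (measurable_symGammaDensity α β).ennreal_ofReal]
  simp [symGammaDensity]

/-- Almost everywhere `x²ᵏ` times the density is a function of `|x|`; the exception `x = 0` comes
from the conventions for `0 ^ α`. -/
lemma symGammaDensity_mul_pow_ae (α β : ℝ) (k : ℕ) :
    (fun x => symGammaDensity α β x * x ^ (2 * k)) =ᵐ[volume] fun x =>
      β / (2 * Real.Gamma ((α + 1) / β)) * (|x| ^ (α + 2 * k) * Real.exp (-|x| ^ β)) := by
  filter_upwards [Measure.ae_ne volume (0 : ℝ)] with x hx
  have h1 : x ^ (2 * k) = |x| ^ ((2 : ℝ) * k) := by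
    rw [← (even_two_mul k).pow_abs, ← Real.rpow_natCast]
    push_cast; rfl
  rw [h1, symGammaDensity, Real.rpow_add (abs_pos.2 hx)]
  ring

lemma lintegral_ofReal_pow_symGammaLaw {α β : ℝ} (hα : -1 < α) (hβ : 0 < β) (k : ℕ) :
    ∫⁻ x, ENNReal.ofReal (x ^ (2 * k)) ∂(symGammaLaw α β) =
      ENNReal.ofReal (Real.Gamma ((α + 2 * k + 1) / β) / Real.Gamma ((α + 1) / β)) := by
  have hk : -1 < α + 2 * k := by
    have : (0 : ℝ) ≤ k := k.cast_nonneg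
    linarith
  have hG : 0 < Real.Gamma ((α + 1) / β) := Real.Gamma_pos_of_pos (div_pos (by linarith) hβ)
  have hval : ∫ x : ℝ, |x| ^ (α + 2 * k) * Real.exp (-|x| ^ β) =
      2 * (1 / β * Real.Gamma ((α + 2 * k + 1) / β)) := by
    rw [integral_comp_abs (f := fun x => x ^ (α + 2 * k) * Real.exp (-x ^ β)),
      integral_rpow_mul_exp_neg_rpow hβ hk]
  -- A non-integrable function has Bochner integral `0`, so the positive value gives integrability.
  have hint : Integrable (fun x : ℝ => |x| ^ (α + 2 * k) * Real.exp (-|x| ^ β)) := by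
    refine Integrable.of_integral_ne_zero ?_
    have := Real.Gamma_pos_of_pos (div_pos (show 0 < α + 2 * k + 1 by linarith) hβ)
    rw [hval]
    positivity
  have hc := hint.const_mul (β / (2 * Real.Gamma ((α + 1) / β)))
  rw [symGammaLaw, lintegral_withDensity_eq_lintegral_mul _
    (measurable_symGammaDensity α β).ennreal_ofReal (by fun_prop)]
  simp only [Pi.mul_apply]
  have hd : ∀ x, 0 ≤ symGammaDensity α β x := fun x => by
    unfold symGammaDensity; positivity
  simp_rw [← ENNReal.ofReal_mul (hd _)]
  rw [lintegral_congr_ae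
      ((symGammaDensity_mul_pow_ae α β k).mono fun x hx => congrArg ENNReal.ofReal hx),
    ← ofReal_integral_eq_lintegral_ofReal hc
      (Filter.Eventually.of_forall fun x => by simp only [Pi.zero_apply]; positivity),
    integral_const_mul, hval]
  congr 1
  field_simp

lemma IsStrictlySubgaussian.of_hasLaw {Ω : Type*} [MeasurableSpace Ω] {P : Measure Ω}
    {X : Ω → ℝ} {μ : Measure ℝ} (hX : HasLaw X μ P)
    (h : IsStrictlySubgaussian (fun x : ℝ => x) μ) : IsStrictlySubgaussian X P := by
  have hexp : ∀ t : ℝ, ∫ ω, Real.exp (t * X ω) ∂P = ∫ x, Real.exp (t * x) ∂μ := fun t =>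
    hX.integral_comp (f := fun x => Real.exp (t * x))
      (Measurable.aestronglyMeasurable (by fun_prop))
  obtain ⟨⟨hint, hzero, τ, hτ, hb⟩, hle⟩ := h
  have hintX : ∀ f : ℝ → ℝ, Integrable f μ → Integrable (fun ω => f (X ω)) P := fun f hf => by
    rw [← hX.map_eq] at hf
    exact hf.comp_aemeasurable hX.aemeasurable
  refine ⟨⟨hintX _ hint, ?_, τ, hτ, fun t => ⟨hintX _ (hb t).1, ?_⟩⟩, fun t => ?_⟩
  · rw [hX.integral_eq]; exact hzero
  · rw [hexp]; exact (hb t).2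
  · rw [hexp, hX.variance_eq]; exact hle t

theorem theorem5p2 {Ω : Type*} [MeasurableSpace Ω] (P : Measure Ω) [IsProbabilityMeasure P]
    (α β : ℝ) (hα : -1 < α) (hβ : 2 < β)
    (γ : Ω → ℝ) (hγ : HasLaw γ (symGammaLaw α β) P)
    (hζ : ∀ k : ℕ, (k : ℝ) < symGammaG α β → symGammaZeta α β k ≤ 1) :
    IsStrictlySubgaussian γ P := by
  have hβ0 : 0 < β := by linarith
  have : IsProbabilityMeasure (symGammaLaw α β) := hγ.isProbabilityMeasure_iff.1 inferInstance
  have hmom := fun k => lintegral_ofReal_pow_symGammaLaw hα hβ0 k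
  refine IsStrictlySubgaussian.of_hasLaw hγ (isStrictlySubgaussian_id_of_moments
    (v := Real.Gamma ((α + 3) / β) / Real.Gamma ((α + 1) / β))
    (measurePreserving_neg_symGammaLaw α β) ?_ ?_ fun k => ?_)
  · exact div_nonneg (Real.Gamma_pos_of_pos (div_pos (by linarith) hβ0)).le
      (Real.Gamma_pos_of_pos (div_pos (by linarith) hβ0)).le
  · have h := hmom 1
    rwa [Nat.cast_one, show α + 2 * 1 + 1 = α + 3 by ring] at h
  · rw [hmom k]
    exact ENNReal.ofReal_le_ofReal (symGamma_moment_le hα hβ hζ k)
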